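/- Let $S$ be a nonempty set of states, $\Sigma$ an algebra of subsets of $S$, and $X$ a convex subset of a real vector space (the consequences). Let $\mathcal F$ be the set of simple acts, i.e. the $\Sigma$-measurable maps $f:S\to X$ with finitely many values; consequences are identified with constant acts, and mixtures of acts are taken statewise. Let $\Delta$ be the set of finitely additive probabilities on $\Sigma$, with the weak* topology (the coarsest topology making $p\mapsto\int\varphi\,dp$ continuous for every real-valued $\Sigma$-measurable function $\varphi$ with finitely many values). Let $\succsim$ be an invariant biseparable (IB) preference on $\mathcal F$, i.e. a nontrivial, complete and transitive binary relation such that, for all $f,g,h\in\mathcal F$: - (Monotonicity) if $f(s)\succsim g(s)$ for all $s\in S$, then $f\succsim g$; - (Archimedean) if $f\succ g\succ h$, then $\alpha f+(1-\alpha)h\succ g\succ\beta f+(1-\beta)h$ for some $\alpha,\beta\in(0,1)$; - (C-Independence) for all $x\in X$ and $\alpha\in(0,1)$, $f\succsim g\Leftrightarrow \alpha f+(1-\alpha)x\succsim\alpha g+(1-\alpha)x$. Let $u:X\to\mathbb R$ be a utility index of $\succsim$, i.e. a nonconstant affine function with $x\succsim y\Leftrightarrow u(x)\ge u(y)$ for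 all $x,y\in X$. For $f\in\mathcal F$ let $x_f\in X$ denote a certainty equivalent of $f$, i.e. $x_f\sim f$. Put $$\mathscr P^*=\Big\{P\subseteq\Delta \,\Big|\, P \text{ nonempty, convex and compact, } \min_{p\in P}\int u(f)\,dp\le u(x_f)\text{ for all }f\in\mathcal F\Big\},$$ $$\mathscr Q^*=\Big\{Q\subseteq\Delta \,\Big|\, Q \text{ nonempty, convex and compact, } \max_{q\in Q}\int u(f)\,dq\ge u(x_f)\text{ for all }f\in\mathcal F\Big\}.$$ A relation $\succsim_0$ on $\mathcal F$ is an SEU preference if there are a nonconstant affine $v:X\to\mathbb R$ and $p_0\in\Delta$ such that $f\succsim_0 g\Leftrightarrow\int v(f)\,dp_0\ge\int v(g)\,dp_0$ for all $f,g\in\mathcal F$. The preference $\succsim$ is ambiguity averse if there is an SEU preference $\succsim_0$ such that $x\succsim_0 f$ implies $x\succsim f$ for all $f\in\mathcal F$ and $x\in X$. Then the following conditions are equivalent: 1. $\succsim$ is ambiguity averse; 2. $\bigcap_{P\in\mathscr P^*}P\neq\emptyset$; 3. $\mathscr Q^*$ contains a singleton. -/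

import Mathlib

/-! Decision-theoretic setting: states `S`, an algebra `𝒜` of events, and consequences forming a
convex subset `X` of a real vector space `E`. -/

namespace IBPref

section Simple

variable {S Y Z : Type*}

/-- `f` has finitely many values and is measurable with respect to the algebra `𝒜`. For a function
with finitely many values it is enough to look at preimages of points. -/
def IsSimple (𝒜 : Set (Set S)) (f : S → Y) : Prop :=
  (Set.range f).Finite ∧ ∀ y, f ⁻¹' {y} ∈ 𝒜

theorem IsSimple.comp {𝒜 : Set (Set S)} (h𝒜 : MeasureTheory.IsSetAlgebra 𝒜) {f : S → Y}
    (hf : IsSimple 𝒜 f) (g : Y → Z) : IsSimple 𝒜 (fun s => g (f s)) := by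
  classical
  refine ⟨(hf.1.image g).subset ?_, fun z => ?_⟩
  · rintro _ ⟨s, rfl⟩
    exact ⟨f s, ⟨s, rfl⟩, rfl⟩
  · have key : (fun s => g (f s)) ⁻¹' {z} =
        ⋃ y ∈ hf.1.toFinset.filter (fun y => g y = z), f ⁻¹' {y} := by
      ext s
      simp
    rw [key]
    exact h𝒜.biUnion_mem _ (fun y _ => hf.2 y)

theorem IsSimple.prodMk {𝒜 : Set (Set S)} (h𝒜 : MeasureTheory.IsSetAlgebra 𝒜) {f : S → Y}
    {g : S → Z} (hf : IsSimple 𝒜 f) (hg : IsSimple 𝒜 g) :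
    IsSimple 𝒜 (fun s => (f s, g s)) := by
  refine ⟨(hf.1.prod hg.1).subset ?_, fun z => ?_⟩
  · rintro _ ⟨s, rfl⟩
    exact ⟨⟨s, rfl⟩, ⟨s, rfl⟩⟩
  · have key : (fun s => (f s, g s)) ⁻¹' {z} = f ⁻¹' {z.1} ∩ g ⁻¹' {z.2} := by
      ext s
      simp [Prod.ext_iff]
    rw [key]
    exact h𝒜.inter_mem (hf.2 _) (hg.2 _)

theorem isSimple_const {𝒜 : Set (Set S)} (h𝒜 : MeasureTheory.IsSetAlgebra 𝒜) (y : Y) :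
    IsSimple 𝒜 (fun _ : S => y) := by
  refine ⟨Set.finite_range_const, fun z => ?_⟩
  by_cases h : y = z
  · rw [Set.preimage_const_of_mem (by simpa using h)]
    exact h𝒜.univ_mem
  · rw [Set.preimage_const_of_notMem (by simpa using h)]
    exact h𝒜.empty_mem

/-- Simple `𝒜`-measurable functions with values in `Y`. For `Y = ℝ` this is `B₀(Σ)`. -/
structure SimpleFun (𝒜 : Set (Set S)) (Y : Type*) where
  toFun : S → Y
  isSimple : IsSimple 𝒜 toFun

end Simple

section Charge

variable {S : Type*}

/-- A finitely additive probability on the algebra `𝒜`. -/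
@[ext]
structure FinAddProb (𝒜 : Set (Set S)) where
  toFun : 𝒜 → ℝ
  nonneg : ∀ A, 0 ≤ toFun A
  univ_eq_one : ∀ h : Set.univ ∈ 𝒜, toFun ⟨Set.univ, h⟩ = 1
  union_eq_add : ∀ (A B : Set S) (hA : A ∈ 𝒜) (hB : B ∈ 𝒜) (hAB : A ∪ B ∈ 𝒜), Disjoint A B →
    toFun ⟨A ∪ B, hAB⟩ = toFun ⟨A, hA⟩ + toFun ⟨B, hB⟩

variable {𝒜 : Set (Set S)}

/-- `∫ φ dp` for a simple function `φ`. -/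
noncomputable def FinAddProb.integral (p : FinAddProb 𝒜) (φ : SimpleFun 𝒜 ℝ) : ℝ :=
  ∑ r ∈ φ.isSimple.1.toFinset, r * p.toFun ⟨φ.toFun ⁻¹' {r}, φ.isSimple.2 r⟩

/-- The weak* topology `σ(Δ, B₀(Σ))`: the coarsest one making all `p ↦ ∫ φ dp` continuous. -/
noncomputable instance FinAddProb.instTopologicalSpace : TopologicalSpace (FinAddProb 𝒜) :=
  ⨅ φ : SimpleFun 𝒜 ℝ,
    TopologicalSpace.induced (fun p : FinAddProb 𝒜 => p.integral φ) inferInstance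

/-- Convexity of a set of finitely additive probabilities (under setwise mixtures). -/
def IsConvex (P : Set (FinAddProb 𝒜)) : Prop :=
  Convex ℝ (FinAddProb.toFun '' P)

end Charge

section Preference

variable {S : Type*} {𝒜 : Set (Set S)} {E : Type*} [AddCommGroup E] [Module ℝ E] {X : Set E}

/-- The simple acts: simple functions from states to consequences. -/
abbrev Act (𝒜 : Set (Set S)) (X : Set E) : Type _ := SimpleFun 𝒜 X

/-- The constant act with value `x`. -/
def Act.const (h𝒜 : MeasureTheory.IsSetAlgebra 𝒜) (x : X) : Act 𝒜 X :=
  ⟨fun _ => x, isSimple_const h𝒜 x⟩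

/-- The mixture `α x + (1 - α) y` of two consequences. -/
def mixCons (hX : Convex ℝ X) (α : unitInterval) (x y : X) : X :=
  ⟨(α : ℝ) • (x : E) + (1 - (α : ℝ)) • (y : E),
    hX x.2 y.2 α.2.1 (sub_nonneg.2 α.2.2) (by ring)⟩

/-- The statewise mixture `α f + (1 - α) g` of two acts. -/
def Act.mix (h𝒜 : MeasureTheory.IsSetAlgebra 𝒜) (hX : Convex ℝ X) (α : unitInterval)
    (f g : Act 𝒜 X) : Act 𝒜 X :=
  ⟨fun s => mixCons hX α (f.toFun s) (g.toFun s),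
    (f.isSimple.prodMk h𝒜 g.isSimple).comp h𝒜 (fun z => mixCons hX α z.1 z.2)⟩

/-- The function `u(f)` in `B₀(Σ)`. -/
def Act.util (h𝒜 : MeasureTheory.IsSetAlgebra 𝒜) (u : X → ℝ) (f : Act 𝒜 X) : SimpleFun 𝒜 ℝ :=
  ⟨fun s => u (f.toFun s), f.isSimple.comp h𝒜 u⟩

/-- The asymmetric part of a preference relation. -/
def Strict (R : Act 𝒜 X → Act 𝒜 X → Prop) (f g : Act 𝒜 X) : Prop := R f g ∧ ¬ R g f

/-- The symmetric part of a preference relation. -/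
def Indiff (R : Act 𝒜 X → Act 𝒜 X → Prop) (f g : Act 𝒜 X) : Prop := R f g ∧ R g f

/-- Invariant biseparable preferences: nontrivial weak orders satisfying monotonicity, the
Archimedean axiom and C-independence. `R f g` reads "`f` is weakly preferred to `g`". -/
structure IsIBPreference (h𝒜 : MeasureTheory.IsSetAlgebra 𝒜) (hX : Convex ℝ X)
    (R : Act 𝒜 X → Act 𝒜 X → Prop) : Prop where
  nontrivial : ∃ f g, Strict R f g
  complete : ∀ f g, R f g ∨ R g f
  transitive : ∀ f g h, R f g → R g h → R f h
  monotone : ∀ f g : Act 𝒜 X,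
    (∀ s, R (Act.const h𝒜 (f.toFun s)) (Act.const h𝒜 (g.toFun s))) → R f g
  archimedean : ∀ f g h, Strict R f g → Strict R g h →
    ∃ α β : unitInterval, (0 < α ∧ α < 1) ∧ (0 < β ∧ β < 1) ∧
      Strict R (Act.mix h𝒜 hX α f h) g ∧ Strict R g (Act.mix h𝒜 hX β f h)
  c_independence : ∀ (f g : Act 𝒜 X) (x : X) (α : unitInterval), 0 < α → α < 1 →
    (R f g ↔ R (Act.mix h𝒜 hX α f (Act.const h𝒜 x)) (Act.mix h𝒜 hX α g (Act.const h𝒜 x)))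

/-- `u` is a nonconstant affine function on the convex set of consequences. -/
structure IsNonconstAffine (hX : Convex ℝ X) (u : X → ℝ) : Prop where
  nonconst : ∃ x y, u x ≠ u y
  affine : ∀ (α : unitInterval) (x y : X),
    u (mixCons hX α x y) = (α : ℝ) * u x + (1 - (α : ℝ)) * u y

/-- `u` is a utility index of `R`: nonconstant, affine, and representing `R` on constant acts. -/
structure IsUtilityIndex (h𝒜 : MeasureTheory.IsSetAlgebra 𝒜) (hX : Convex ℝ X)
    (R : Act 𝒜 X → Act 𝒜 X → Prop) (u : X → ℝ) : Prop extends IsNonconstAffine hX u where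
  represents : ∀ x y : X, R (Act.const h𝒜 x) (Act.const h𝒜 y) ↔ u y ≤ u x

/-- Subjective expected utility preferences. -/
def IsSEU (h𝒜 : MeasureTheory.IsSetAlgebra 𝒜) (hX : Convex ℝ X)
    (R : Act 𝒜 X → Act 𝒜 X → Prop) : Prop :=
  ∃ (u : X → ℝ) (p : FinAddProb 𝒜), IsNonconstAffine hX u ∧
    ∀ f g, R f g ↔ p.integral (g.util h𝒜 u) ≤ p.integral (f.util h𝒜 u)

/-- `R₁` is more ambiguity averse than `R₂`. -/
def MoreAmbiguityAverse (h𝒜 : MeasureTheory.IsSetAlgebra 𝒜)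
    (R₁ R₂ : Act 𝒜 X → Act 𝒜 X → Prop) : Prop :=
  ∀ (f : Act 𝒜 X) (x : X), R₂ (Act.const h𝒜 x) f → R₁ (Act.const h𝒜 x) f

/-- `R` is ambiguity averse: more ambiguity averse than some SEU preference. -/
def IsAmbiguityAverse (h𝒜 : MeasureTheory.IsSetAlgebra 𝒜) (hX : Convex ℝ X)
    (R : Act 𝒜 X → Act 𝒜 X → Prop) : Prop :=
  ∃ R₀ : Act 𝒜 X → Act 𝒜 X → Prop, IsSEU h𝒜 hX R₀ ∧ MoreAmbiguityAverse h𝒜 R R₀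

/-- The family `𝒫*` of the convex and weak* compact sets `P` such that
`min_{p ∈ P} ∫ u(f) dp ≤ u(x_f)` for every act `f`, where `x_f` is a certainty equivalent of `f`.
The minimum is required to exist, so `P` is nonempty. -/
def maxminFamily (h𝒜 : MeasureTheory.IsSetAlgebra 𝒜) (R : Act 𝒜 X → Act 𝒜 X → Prop)
    (u : X → ℝ) : Set (Set (FinAddProb 𝒜)) :=
  {P | IsConvex P ∧ IsCompact P ∧
    ∀ f : Act 𝒜 X, ∃ m, IsLeast ((fun p : FinAddProb 𝒜 => p.integral (f.util h𝒜 u)) '' P) m ∧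
      ∀ x : X, Indiff R f (Act.const h𝒜 x) → m ≤ u x}

/-- The family `𝒬*` of the convex and weak* compact sets `Q` such that
`max_{q ∈ Q} ∫ u(f) dq ≥ u(x_f)` for every act `f`, where `x_f` is a certainty equivalent of `f`.
The maximum is required to exist, so `Q` is nonempty. -/
def minmaxFamily (h𝒜 : MeasureTheory.IsSetAlgebra 𝒜) (R : Act 𝒜 X → Act 𝒜 X → Prop)
    (u : X → ℝ) : Set (Set (FinAddProb 𝒜)) :=
  {Q | IsConvex Q ∧ IsCompact Q ∧
    ∀ f : Act 𝒜 X, ∃ m, IsGreatest ((fun q : FinAddProb 𝒜 => q.integral (f.util h𝒜 u)) '' Q) m ∧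
      ∀ x : X, Indiff R f (Act.const h𝒜 x) → u x ≤ m}

end Preference

end IBPref

/-! Write `I(u(f)) = u(x_f)`. The preference axioms make `I` monotone and constant-linear. 1 ⇔ 3:
the benchmark has a prior `q` and a utility `v` not known to be equivalent to `u`, but a barycenter
`y` of `f` under `q` has the expected value of both, so `y ∼₀ f` forces `u(x_f) ≤ u(y) = ∫ u(f) dq`.
Conversely `q` with `u` itself is a benchmark. 3 ⇒ 2: if `q ∉ P`, Hahn-Banach gives a simple
function, rescaled to an act `f`, with `∫ u(f) dq` below the minimum over `P`, hence below `u(x_f)`.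
2 ⇒ 3: every half-space `{p | u(x_f) ≤ ∫ u(f) dp}` lies in `𝒫*`, so a point common to all of `𝒫*`
satisfies every inequality of condition 3. For this, each act `g` needs a `p` in the half-space with
`∫ u(g) dp ≤ u(x_g)`. Otherwise separation (`FinAddProb.exists_le_integral_or`) yields `a (u(f) -
u(x_f)) + ε ≤ b (u(g) - u(x_g))` in every state, which `I` turns into `ε ≤ 0`
(`IsIBPreference.not_forall_add_le`). -/

namespace IBPref

/-! ### Finitely additive probabilities and integrals of simple functions. -/

section Charge

variable {S : Type*} {𝒜 : Set (Set S)}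

open Classical in
/-- The probability of `A`, set to `0` outside the algebra. -/
noncomputable def FinAddProb.prob (p : FinAddProb 𝒜) (A : Set S) : ℝ :=
  if h : A ∈ 𝒜 then p.toFun ⟨A, h⟩ else 0

theorem FinAddProb.prob_of_mem (p : FinAddProb 𝒜) {A : Set S} (h : A ∈ 𝒜) :
    p.prob A = p.toFun ⟨A, h⟩ := dif_pos h

theorem FinAddProb.prob_nonneg (p : FinAddProb 𝒜) (A : Set S) : 0 ≤ p.prob A := by
  unfold FinAddProb.prob
  split_ifs with h
  · exact p.nonneg _
  · exact le_rfl

theorem FinAddProb.prob_univ (h𝒜 : MeasureTheory.IsSetAlgebra 𝒜) (p : FinAddProb 𝒜) :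
    p.prob Set.univ = 1 := by
  rw [p.prob_of_mem h𝒜.univ_mem, p.univ_eq_one]

theorem FinAddProb.prob_union (h𝒜 : MeasureTheory.IsSetAlgebra 𝒜) (p : FinAddProb 𝒜)
    {A B : Set S} (hA : A ∈ 𝒜) (hB : B ∈ 𝒜) (hAB : Disjoint A B) :
    p.prob (A ∪ B) = p.prob A + p.prob B := by
  rw [p.prob_of_mem hA, p.prob_of_mem hB, p.prob_of_mem (h𝒜.union_mem hA hB),
    p.union_eq_add A B hA hB _ hAB]

theorem FinAddProb.prob_empty (h𝒜 : MeasureTheory.IsSetAlgebra 𝒜) (p : FinAddProb 𝒜) :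
    p.prob ∅ = 0 := by
  have h := p.prob_union h𝒜 h𝒜.empty_mem h𝒜.empty_mem (Set.disjoint_empty _)
  rw [Set.union_empty] at h
  linarith

theorem FinAddProb.prob_biUnion (h𝒜 : MeasureTheory.IsSetAlgebra 𝒜) (p : FinAddProb 𝒜)
    {ι : Type*} (t : Finset ι) (A : ι → Set S) (hA : ∀ i ∈ t, A i ∈ 𝒜)
    (hd : (t : Set ι).PairwiseDisjoint A) :
    p.prob (⋃ i ∈ t, A i) = ∑ i ∈ t, p.prob (A i) := by
  classical
  induction t using Finset.induction_on with
  | empty => simp [p.prob_empty h𝒜]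
  | insert i t hi ih =>
    have hA' : ∀ j ∈ t, A j ∈ 𝒜 := fun j hj => hA j (Finset.mem_insert_of_mem hj)
    rw [Finset.set_biUnion_insert, p.prob_union h𝒜 (hA i (Finset.mem_insert_self i t))
      (h𝒜.biUnion_mem t hA'), Finset.sum_insert hi, ih hA']
    · exact hd.subset (by simp)
    · refine Set.disjoint_iUnion₂_right.2 fun j hj => ?_
      exact hd (by simp) (by simp [hj]) (fun h => hi (h ▸ hj))

theorem FinAddProb.sum_prob_fiber (h𝒜 : MeasureTheory.IsSetAlgebra 𝒜) (p : FinAddProb 𝒜)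
    {Y Z : Type*} [DecidableEq Z] {f : S → Y} (hf : IsSimple 𝒜 f) (g : Y → Z) (z : Z) :
    p.prob ((fun s => g (f s)) ⁻¹' {z}) =
      ∑ y ∈ hf.1.toFinset with g y = z, p.prob (f ⁻¹' {y}) := by
  have key : (fun s => g (f s)) ⁻¹' {z} =
      ⋃ y ∈ hf.1.toFinset.filter (fun y => g y = z), f ⁻¹' {y} := by
    ext s
    simp
  rw [key, p.prob_biUnion h𝒜 _ _ fun y _ => hf.2 y]
  intro y _ y' _ hne
  exact (Set.disjoint_singleton.2 hne).preimage f

/-- The integral may be computed on any finite partition refining the level sets. Linearity follows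
by using the joint partition of two functions. -/
theorem FinAddProb.integral_comp (h𝒜 : MeasureTheory.IsSetAlgebra 𝒜) (p : FinAddProb 𝒜)
    {Y : Type*} {f : S → Y} (hf : IsSimple 𝒜 f) (g : Y → ℝ) (φ : SimpleFun 𝒜 ℝ)
    (hφ : ∀ s, φ.toFun s = g (f s)) :
    p.integral φ = ∑ y ∈ hf.1.toFinset, p.prob (f ⁻¹' {y}) * g y := by
  classical
  have hφ' : φ.toFun = fun s => g (f s) := funext hφ
  have hmaps : ∀ y ∈ hf.1.toFinset, g y ∈ φ.isSimple.1.toFinset := by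
    intro y hy
    obtain ⟨s, rfl⟩ := hf.1.mem_toFinset.1 hy
    exact φ.isSimple.1.mem_toFinset.2 ⟨s, hφ s⟩
  rw [← Finset.sum_fiberwise_of_maps_to hmaps]
  refine Finset.sum_congr rfl fun r _ => ?_
  rw [← p.prob_of_mem, hφ', p.sum_prob_fiber h𝒜 hf, Finset.mul_sum]
  refine Finset.sum_congr rfl fun y hy => ?_
  rw [(Finset.mem_filter.1 hy).2, mul_comm]

theorem FinAddProb.sum_prob (h𝒜 : MeasureTheory.IsSetAlgebra 𝒜) (p : FinAddProb 𝒜)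
    {Y : Type*} {f : S → Y} (hf : IsSimple 𝒜 f) :
    ∑ y ∈ hf.1.toFinset, p.prob (f ⁻¹' {y}) = 1 := by
  classical
  -- Mapping to a one-point type makes the whole state space a single fiber.
  have h := p.sum_prob_fiber h𝒜 hf (fun _ => ()) ()
  rw [Set.preimage_const_of_mem (by simp), p.prob_univ h𝒜] at h
  simpa using h.symm

theorem FinAddProb.integral_add_mul (h𝒜 : MeasureTheory.IsSetAlgebra 𝒜) (p : FinAddProb 𝒜)
    (φ ψ χ : SimpleFun 𝒜 ℝ) (a b c : ℝ)
    (h : ∀ s, χ.toFun s = a * φ.toFun s + b * ψ.toFun s + c) :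
    p.integral χ = a * p.integral φ + b * p.integral ψ + c := by
  have hf := φ.isSimple.prodMk h𝒜 ψ.isSimple
  rw [p.integral_comp h𝒜 hf (fun z => a * z.1 + b * z.2 + c) χ h,
    p.integral_comp h𝒜 hf Prod.fst φ fun _ => rfl,
    p.integral_comp h𝒜 hf Prod.snd ψ fun _ => rfl]
  simp only [mul_add, Finset.sum_add_distrib, Finset.mul_sum, ← Finset.sum_mul,
    p.sum_prob h𝒜 hf, one_mul]
  congr 2 <;> exact Finset.sum_congr rfl fun _ _ => by ring

theorem FinAddProb.integral_const (h𝒜 : MeasureTheory.IsSetAlgebra 𝒜) (p : FinAddProb 𝒜)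
    (φ : SimpleFun 𝒜 ℝ) (c : ℝ) (h : ∀ s, φ.toFun s = c) : p.integral φ = c := by
  simpa using p.integral_add_mul h𝒜 φ φ φ 0 0 c (by simpa using h)

/-- The indicator function of an event. -/
noncomputable def SimpleFun.indicator (h𝒜 : MeasureTheory.IsSetAlgebra 𝒜) (A : 𝒜) :
    SimpleFun 𝒜 ℝ where
  toFun := (A : Set S).indicator 1
  isSimple := by
    classical
    refine ⟨(Set.toFinite {0, 1}).subset ?_, fun r => ?_⟩
    · rintro _ ⟨s, rfl⟩
      by_cases h : s ∈ (A : Set S) <;> simp [h]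
    · rcases Set.indicator_one_preimage (M := ℝ) (A : Set S) {r} with h | h | h | h
      · rw [h]; exact h𝒜.univ_mem
      · rw [h]; exact A.2
      · rw [h]; exact h𝒜.compl_mem A.2
      · rw [h]; exact h𝒜.empty_mem

theorem FinAddProb.integral_indicator (h𝒜 : MeasureTheory.IsSetAlgebra 𝒜) (p : FinAddProb 𝒜)
    (A : 𝒜) : p.integral (SimpleFun.indicator h𝒜 A) = p.toFun A := by
  classical
  have hf : IsSimple 𝒜 (fun s => (A : Set S).indicator (1 : S → ℝ) s) :=
    (SimpleFun.indicator h𝒜 A).isSimple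
  have h1 : (SimpleFun.indicator h𝒜 A).toFun ⁻¹' {1} = A := by
    ext s
    by_cases h : s ∈ (A : Set S) <;> simp [SimpleFun.indicator, h]
  unfold FinAddProb.integral
  rw [Finset.sum_eq_single (1 : ℝ)]
  · simp [h1]
  · intro r hr hr1
    obtain ⟨s, rfl⟩ := (SimpleFun.indicator h𝒜 A).isSimple.1.mem_toFinset.1 hr
    by_cases h : s ∈ (A : Set S)
    · exact absurd (by simp [SimpleFun.indicator, h]) hr1
    · simp [SimpleFun.indicator, h]
  · intro h
    have h0 : (SimpleFun.indicator h𝒜 A).toFun ⁻¹' {1} = ∅ := by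
      ext s
      simp only [Set.mem_preimage, Set.mem_singleton_iff, Set.mem_empty_iff_false, iff_false]
      exact fun hs => h ((Set.Finite.mem_toFinset _).2 ⟨s, hs⟩)
    rw [← p.prob_of_mem, h0, p.prob_empty h𝒜, mul_zero]

/-- The point mass at a state. -/
noncomputable def FinAddProb.dirac (s : S) : FinAddProb 𝒜 where
  toFun A := (A : Set S).indicator 1 s
  nonneg A := Set.indicator_nonneg (fun _ _ => zero_le_one) s
  univ_eq_one _ := by simp
  union_eq_add A B _ _ _ hd := by
    simp only [Set.indicator_union_of_disjoint hd]

theorem FinAddProb.integral_dirac (s : S) (φ : SimpleFun 𝒜 ℝ) :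
    (FinAddProb.dirac s : FinAddProb 𝒜).integral φ = φ.toFun s := by
  unfold FinAddProb.integral
  rw [Finset.sum_eq_single (φ.toFun s)]
  · simp [FinAddProb.dirac]
  · intro r _ hr
    simp [FinAddProb.dirac, hr.symm]
  · intro h
    exact absurd (φ.isSimple.1.mem_toFinset.2 ⟨s, rfl⟩) h

/-- The setwise mixture of two finitely additive probabilities. -/
noncomputable def FinAddProb.mix (p q : FinAddProb 𝒜) (a b : ℝ) (ha : 0 ≤ a) (hb : 0 ≤ b)
    (hab : a + b = 1) : FinAddProb 𝒜 where
  toFun := a • p.toFun + b • q.toFun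
  nonneg A := add_nonneg (mul_nonneg ha (p.nonneg A)) (mul_nonneg hb (q.nonneg A))
  univ_eq_one h := by simp [p.univ_eq_one, q.univ_eq_one, hab]
  union_eq_add A B hA hB hAB hd := by
    simp only [Pi.add_apply, Pi.smul_apply, smul_eq_mul, p.union_eq_add A B hA hB hAB hd,
      q.union_eq_add A B hA hB hAB hd]
    ring

theorem FinAddProb.integral_mix (p q : FinAddProb 𝒜) (a b : ℝ) (ha : 0 ≤ a) (hb : 0 ≤ b)
    (hab : a + b = 1) (φ : SimpleFun 𝒜 ℝ) :
    (p.mix q a b ha hb hab).integral φ = a * p.integral φ + b * q.integral φ := by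
  simp only [FinAddProb.integral, FinAddProb.mix, Finset.mul_sum, ← Finset.sum_add_distrib]
  refine Finset.sum_congr rfl fun r _ => ?_
  simp only [Pi.add_apply, Pi.smul_apply, smul_eq_mul]
  ring

/-! ### The weak* topology and compactness. -/

theorem FinAddProb.continuous_integral (φ : SimpleFun 𝒜 ℝ) :
    Continuous (fun p : FinAddProb 𝒜 => p.integral φ) :=
  continuous_iInf_dom (i := φ) continuous_induced_dom

theorem FinAddProb.continuous_toFun (h𝒜 : MeasureTheory.IsSetAlgebra 𝒜) :
    Continuous (FinAddProb.toFun : FinAddProb 𝒜 → 𝒜 → ℝ) := by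
  refine continuous_pi fun A => ?_
  simpa only [FinAddProb.integral_indicator] using
    FinAddProb.continuous_integral (SimpleFun.indicator h𝒜 A)

theorem FinAddProb.toFun_le_one (h𝒜 : MeasureTheory.IsSetAlgebra 𝒜) (p : FinAddProb 𝒜)
    (A : 𝒜) : p.toFun A ≤ 1 := by
  have h := p.prob_union h𝒜 A.2 (h𝒜.compl_mem A.2) disjoint_compl_right
  rw [Set.union_compl_self, p.prob_univ h𝒜, p.prob_of_mem A.2] at h
  have := p.prob_nonneg (A : Set S)ᶜ
  linarith

/-- Banach–Alaoglu for finitely additive probabilities. -/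
theorem FinAddProb.compactSpace (h𝒜 : MeasureTheory.IsSetAlgebra 𝒜) :
    CompactSpace (FinAddProb 𝒜) := by
  -- `K` is the copy of `Δ` in `ℝ^𝒜`: each axiom is a closed condition on finitely many coordinates,
  -- and `K` sits in the cube `[0,1]^𝒜`, compact by Tychonoff.
  let K : Set (𝒜 → ℝ) := {μ | (∀ A, 0 ≤ μ A) ∧ (∀ h : Set.univ ∈ 𝒜, μ ⟨Set.univ, h⟩ = 1) ∧
    ∀ (A B : Set S) (hA : A ∈ 𝒜) (hB : B ∈ 𝒜) (hAB : A ∪ B ∈ 𝒜), Disjoint A B →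
      μ ⟨A ∪ B, hAB⟩ = μ ⟨A, hA⟩ + μ ⟨B, hB⟩}
  let e : K → FinAddProb 𝒜 := fun μ => ⟨μ.1, μ.2.1, μ.2.2.1, μ.2.2.2⟩
  have hclosed : IsClosed K := by
    have hK : K = (⋂ A, {μ | 0 ≤ μ A}) ∩ ((⋂ h : Set.univ ∈ 𝒜, {μ | μ ⟨Set.univ, h⟩ = 1}) ∩
        ⋂ (A : Set S) (B : Set S) (hA : A ∈ 𝒜) (hB : B ∈ 𝒜) (hAB : A ∪ B ∈ 𝒜)
          (_ : Disjoint A B), {μ | μ ⟨A ∪ B, hAB⟩ = μ ⟨A, hA⟩ + μ ⟨B, hB⟩}) := by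
      ext μ
      simp [K]
    rw [hK]
    refine (isClosed_iInter fun A => isClosed_le continuous_const (continuous_apply A)).inter
      ((isClosed_iInter fun h => isClosed_eq (continuous_apply _) continuous_const).inter ?_)
    iterate 6 refine isClosed_iInter fun _ => ?_
    exact isClosed_eq (continuous_apply _) (by fun_prop)
  have hK : IsCompact K := by
    refine (isCompact_univ_pi fun _ : 𝒜 => isCompact_Icc (a := (0 : ℝ)) (b := 1)).of_isClosed_subset
      hclosed fun μ hμ A _ => ⟨hμ.1 A, (e ⟨μ, hμ⟩).toFun_le_one h𝒜 A⟩
  have : CompactSpace K := isCompact_iff_compactSpace.1 hK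
  have he : Continuous e := by
    refine continuous_iInf_rng.2 fun φ => continuous_induced_rng.2 ?_
    refine continuous_finsetSum _ fun r _ => continuous_const.mul ?_
    exact (continuous_apply _).comp continuous_subtype_val
  have hs : Function.Surjective e := fun p =>
    ⟨⟨p.toFun, p.nonneg, p.univ_eq_one, p.union_eq_add⟩, rfl⟩
  exact hs.compactSpace he

/-! ### Separation by simple functions. -/

/-- A continuous functional for the product topology is a finite combination of evaluations, and
evaluation at `A` is integration of the indicator of `A`. -/
theorem SimpleFun.exists_integral_eq (h𝒜 : MeasureTheory.IsSetAlgebra 𝒜)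
    (f : StrongDual ℝ (𝒜 → ℝ)) :
    ∃ φ : SimpleFun 𝒜 ℝ, ∀ p : FinAddProb 𝒜, p.integral φ = f p.toFun := by
  have hf : (f : (𝒜 → ℝ) →ₗ[ℝ] ℝ) ∈
      Submodule.span ℝ (Set.range fun A : 𝒜 => (LinearMap.proj A : (𝒜 → ℝ) →ₗ[ℝ] ℝ)) := by
    rw [LinearMap.mem_span_iff_continuous]
    exact f.continuous
  have key : ∀ g ∈ Submodule.span ℝ
      (Set.range fun A : 𝒜 => (LinearMap.proj A : (𝒜 → ℝ) →ₗ[ℝ] ℝ)),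
      ∃ φ : SimpleFun 𝒜 ℝ, ∀ p : FinAddProb 𝒜, p.integral φ = g p.toFun := by
    intro g hg
    induction hg using Submodule.span_induction with
    | mem g hg =>
      obtain ⟨A, rfl⟩ := hg
      exact ⟨SimpleFun.indicator h𝒜 A, fun p => p.integral_indicator h𝒜 A⟩
    | zero =>
      exact ⟨⟨fun _ => 0, isSimple_const h𝒜 0⟩, fun p => p.integral_const h𝒜 _ 0 fun _ => rfl⟩
    | add g₁ g₂ _ _ h₁ h₂ =>
      obtain ⟨φ, hφ⟩ := h₁
      obtain ⟨ψ, hψ⟩ := h₂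
      refine ⟨⟨_, (φ.isSimple.prodMk h𝒜 ψ.isSimple).comp h𝒜 fun z => z.1 + z.2⟩, fun p => ?_⟩
      rw [p.integral_add_mul h𝒜 φ ψ _ 1 1 0 (by simp), hφ, hψ]
      simp
    | smul c g _ h =>
      obtain ⟨φ, hφ⟩ := h
      refine ⟨⟨_, φ.isSimple.comp h𝒜 fun z => c * z⟩, fun p => ?_⟩
      rw [p.integral_add_mul h𝒜 φ φ _ c 0 0 (by simp), hφ]
      simp
  exact key f hf

theorem FinAddProb.exists_integral_lt (h𝒜 : MeasureTheory.IsSetAlgebra 𝒜)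
    {P : Set (FinAddProb 𝒜)} (hconv : IsConvex P) (hcomp : IsCompact P) {q : FinAddProb 𝒜}
    (hq : q ∉ P) :
    ∃ φ : SimpleFun 𝒜 ℝ, ∀ p ∈ P, q.integral φ < p.integral φ := by
  have hq' : q.toFun ∉ FinAddProb.toFun '' P := by
    rintro ⟨p, hp, h⟩
    exact hq (FinAddProb.ext h ▸ hp)
  obtain ⟨f, c, h₁, h₂⟩ := geometric_hahn_banach_point_closed hconv
    (hcomp.image (FinAddProb.continuous_toFun h𝒜)).isClosed hq'
  obtain ⟨φ, hφ⟩ := SimpleFun.exists_integral_eq h𝒜 f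
  refine ⟨φ, fun p hp => ?_⟩
  rw [hφ, hφ]
  exact h₁.trans (h₂ _ ⟨p, hp, rfl⟩)

theorem isConvex_setOf_le_integral (φ : SimpleFun 𝒜 ℝ) (c : ℝ) :
    IsConvex {p : FinAddProb 𝒜 | c ≤ p.integral φ} := by
  rintro _ ⟨p, hp, rfl⟩ _ ⟨q, hq, rfl⟩ a b ha hb hab
  refine ⟨p.mix q a b ha hb hab, ?_, rfl⟩
  change c ≤ _ at hp hq
  change c ≤ _
  rw [FinAddProb.integral_mix]
  calc c = a * c + b * c := by rw [← add_mul, hab, one_mul]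
    _ ≤ _ := add_le_add (mul_le_mul_of_nonneg_left hp ha) (mul_le_mul_of_nonneg_left hq hb)

/-- Either some finitely additive probability satisfies both constraints, or a nonnegative
combination of the constraints fails uniformly. -/
theorem FinAddProb.exists_le_integral_or (h𝒜 : MeasureTheory.IsSetAlgebra 𝒜) [Nonempty S]
    (φ ψ : SimpleFun 𝒜 ℝ) (c d : ℝ) :
    (∃ p : FinAddProb 𝒜, c ≤ p.integral φ ∧ p.integral ψ ≤ d) ∨
      ∃ a b ε : ℝ, 0 ≤ a ∧ 0 ≤ b ∧ 0 < ε ∧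
        ∀ s, a * (φ.toFun s - c) + ε ≤ b * (ψ.toFun s - d) := by
  by_contra! hcon
  obtain ⟨h₁, h₂⟩ := hcon
  have := FinAddProb.compactSpace h𝒜
  -- If no probability meets both constraints, the compact convex range of `F` misses the closed
  -- positive quadrant and can be strictly separated from it.
  let F : FinAddProb 𝒜 → ℝ × ℝ := fun p => (p.integral φ - c, d - p.integral ψ)
  have hF : Continuous F := ((FinAddProb.continuous_integral φ).sub continuous_const).prodMk
    (continuous_const.sub (FinAddProb.continuous_integral ψ))
  have hconv : Convex ℝ (Set.range F) := by
    rintro _ ⟨p, rfl⟩ _ ⟨q, rfl⟩ a b ha hb hab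
    refine ⟨p.mix q a b ha hb hab, ?_⟩
    simp only [F, FinAddProb.integral_mix, Prod.smul_mk, Prod.mk_add_mk, smul_eq_mul,
      Prod.mk.injEq]
    constructor
    · linear_combination c * hab
    · linear_combination -d * hab
  have hdisj : Disjoint (Set.range F) (Set.Ici (0 : ℝ × ℝ)) := by
    rw [Set.disjoint_left]
    rintro _ ⟨p, rfl⟩ hp
    have hp1 : 0 ≤ p.integral φ - c := hp.1
    have hp2 : 0 ≤ d - p.integral ψ := hp.2
    linarith [h₁ p (by linarith)]
  obtain ⟨f, v, w, hv, hvw, hw⟩ := geometric_hahn_banach_compact_closed hconv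
    (isCompact_range hF) (convex_Ici (𝕜 := ℝ) 0) isClosed_Ici hdisj
  have hw0 : w < 0 := by simpa using hw 0 (Set.mem_Ici.2 le_rfl)
  have hf : ∀ x y : ℝ, f (x, y) = x * f (1, 0) + y * f (0, 1) := fun x y => by
    rw [← smul_eq_mul, ← smul_eq_mul, ← map_smul, ← map_smul, ← map_add]
    simp
  have hpos : ∀ z : ℝ × ℝ, 0 ≤ z → 0 ≤ f z := by
    intro z hz
    by_contra! hneg
    -- Scaling a point with negative value reaches the value `w` inside the cone, where `f` must
    -- exceed `w`.
    have := hw ((w / f z) • z) (smul_nonneg (div_nonneg_of_nonpos hw0.le hneg.le) hz)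
    rw [map_smul, smul_eq_mul, div_mul_cancel₀ _ hneg.ne] at this
    exact this.false
  -- The separating functional supplies `a` and `b`, and its negative bound supplies the slack.
  -- Point masses turn the bound on the range of `F` into a statewise one.
  obtain ⟨s, hs⟩ := h₂ (f (1, 0)) (f (0, 1)) (-v) (hpos _ (by simp [Prod.le_def]))
    (hpos _ (by simp [Prod.le_def])) (by linarith)
  have hs' := hv _ ⟨FinAddProb.dirac s, rfl⟩
  simp only [F, FinAddProb.integral_dirac] at hs'
  rw [hf] at hs'
  linarith

end Charge

/-! ### Condition 3 as a family of inequalities. -/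

section SingletonPrior

variable {S : Type*} {𝒜 : Set (Set S)} {E : Type*} {X : Set E}
  {h𝒜 : MeasureTheory.IsSetAlgebra 𝒜} {R : Act 𝒜 X → Act 𝒜 X → Prop} {u : X → ℝ}

theorem singleton_mem_minmaxFamily_iff (q : FinAddProb 𝒜) :
    {q} ∈ minmaxFamily h𝒜 R u ↔
      ∀ (f : Act 𝒜 X) (x : X), Indiff R f (Act.const h𝒜 x) → u x ≤ q.integral (f.util h𝒜 u) := by
  constructor
  · rintro ⟨-, -, h⟩ f x hx
    obtain ⟨m, hm, hle⟩ := h f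
    rw [Set.image_singleton] at hm
    exact hm.1 ▸ hle x hx
  · intro h
    refine ⟨?_, isCompact_singleton, fun f => ⟨q.integral (f.util h𝒜 u), ?_, h f⟩⟩
    · rw [IsConvex, Set.image_singleton]
      exact convex_singleton _
    · rw [Set.image_singleton]
      exact isGreatest_singleton

end SingletonPrior

/-! ### Affine utilities, certainty equivalents and the three conditions. -/

section Preference

variable {S : Type*} {𝒜 : Set (Set S)} {E : Type*} [AddCommGroup E] [Module ℝ E] {X : Set E}
  {h𝒜 : MeasureTheory.IsSetAlgebra 𝒜} {hX : Convex ℝ X} {R : Act 𝒜 X → Act 𝒜 X → Prop}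
  {u v : X → ℝ}

theorem IsNonconstAffine.convex_range_prod (hv : IsNonconstAffine hX v)
    (hu : IsNonconstAffine hX u) : Convex ℝ (Set.range fun x => (v x, u x)) := by
  rintro _ ⟨x, rfl⟩ _ ⟨y, rfl⟩ a b ha hb hab
  refine ⟨mixCons hX ⟨a, ha, by linarith⟩ x y, ?_⟩
  obtain rfl : b = 1 - a := by linarith
  simp [hv.affine, hu.affine]

theorem IsNonconstAffine.exists_eq (hu : IsNonconstAffine hX u) {x y : X} {r : ℝ}
    (hx : u x ≤ r) (hy : r ≤ u y) : ∃ z, u z = r := by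
  have h : Convex ℝ (Set.range u) := by
    rintro _ ⟨x, rfl⟩ _ ⟨y, rfl⟩ a b ha hb hab
    refine ⟨mixCons hX ⟨a, ha, by linarith⟩ x y, ?_⟩
    obtain rfl : b = 1 - a := by linarith
    simp [hu.affine]
  exact h.ordConnected.out ⟨x, rfl⟩ ⟨y, rfl⟩ ⟨hx, hy⟩

theorem IsNonconstAffine.exists_lt (hu : IsNonconstAffine hX u) : ∃ x y, u x < u y := by
  obtain ⟨x, y, h⟩ := hu.nonconst
  rcases h.lt_or_gt with h | h
  exacts [⟨x, y, h⟩, ⟨y, x, h⟩]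

/-- The expected utilities of an act under two affine utilities are jointly attained by a
consequence, its barycenter. -/
theorem IsNonconstAffine.exists_barycenter (hv : IsNonconstAffine hX v)
    (hu : IsNonconstAffine hX u) (p : FinAddProb 𝒜) (f : Act 𝒜 X) :
    ∃ x, v x = p.integral (f.util h𝒜 v) ∧ u x = p.integral (f.util h𝒜 u) := by
  -- The pair of expected utilities is a finite convex combination of points of the joint range,
  -- which is convex.
  have h := (hv.convex_range_prod hu).sum_mem (t := f.isSimple.1.toFinset)
    (w := fun y => p.prob (f.toFun ⁻¹' {y})) (z := fun y => (v y, u y))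
    (fun y _ => p.prob_nonneg _) (p.sum_prob h𝒜 f.isSimple) fun y _ => ⟨y, rfl⟩
  obtain ⟨x, hx⟩ := h
  refine ⟨x, ?_, ?_⟩
  · rw [p.integral_comp h𝒜 f.isSimple v (f.util h𝒜 v) fun _ => rfl]
    simpa [Prod.fst_sum] using congrArg Prod.fst hx
  · rw [p.integral_comp h𝒜 f.isSimple u (f.util h𝒜 u) fun _ => rfl]
    simpa [Prod.snd_sum] using congrArg Prod.snd hx

theorem IsIBPreference.of_util_le (hR : IsIBPreference h𝒜 hX R) (hu : IsUtilityIndex h𝒜 hX R u)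
    {f g : Act 𝒜 X} (h : ∀ s, u (g.toFun s) ≤ u (f.toFun s)) : R f g :=
  hR.monotone f g fun s => (hu.represents _ _).2 (h s)

theorem IsIBPreference.iff_of_indiff (hR : IsIBPreference h𝒜 hX R)
    (hu : IsUtilityIndex h𝒜 hX R u) {f g : Act 𝒜 X} {x y : X}
    (hf : Indiff R f (Act.const h𝒜 x)) (hg : Indiff R g (Act.const h𝒜 y)) :
    R f g ↔ u y ≤ u x := by
  rw [← hu.represents]
  exact ⟨fun h => hR.transitive _ _ _ hf.2 (hR.transitive _ _ _ h hg.1),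
    fun h => hR.transitive _ _ _ hf.1 (hR.transitive _ _ _ h hg.2)⟩

theorem IsIBPreference.refl (hR : IsIBPreference h𝒜 hX R) (f : Act 𝒜 X) : R f f :=
  (hR.complete f f).elim id id

/-- The candidate has utility equal to the infimum over constants weakly preferred to `f`. It exists
because `u(X)` is an interval, and the Archimedean axiom excludes strict preference either way. -/
theorem IsIBPreference.exists_indiff_const [Nonempty S] (hR : IsIBPreference h𝒜 hX R)
    (hu : IsUtilityIndex h𝒜 hX R u) (f : Act 𝒜 X) : ∃ x, Indiff R f (Act.const h𝒜 x) := by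
  obtain ⟨M, -, hM⟩ := Set.exists_max_image _ u f.isSimple.1 (Set.range_nonempty f.toFun)
  obtain ⟨m, -, hm⟩ := Set.exists_min_image _ u f.isSimple.1 (Set.range_nonempty f.toFun)
  have hMf : R (Act.const h𝒜 M) f := hR.of_util_le hu fun s => hM _ ⟨s, rfl⟩
  have hfm : R f (Act.const h𝒜 m) := hR.of_util_le hu fun s => hm _ ⟨s, rfl⟩
  let T : Set ℝ := u '' {x | R (Act.const h𝒜 x) f}
  have hMT : u M ∈ T := ⟨M, hMf, rfl⟩
  have hlb : u m ∈ lowerBounds T := by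
    rintro _ ⟨x, hx, rfl⟩
    exact (hu.represents x m).1 (hR.transitive _ _ _ hx hfm)
  obtain ⟨x, hx⟩ : ∃ x, u x = sInf T :=
    hu.exists_eq (le_csInf ⟨_, hMT⟩ hlb) (csInf_le ⟨_, hlb⟩ hMT)
  have hfx : R f (Act.const h𝒜 x) := by
    by_contra hn
    have hxf := (hR.complete f (Act.const h𝒜 x)).resolve_left hn
    by_cases hmf : R (Act.const h𝒜 m) f
    · refine hn (hR.transitive _ _ _ hfm ((hu.represents _ _).2 ?_))
      exact hx ▸ csInf_le ⟨_, hlb⟩ ⟨m, hmf, rfl⟩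
    -- If `x ≻ f ≻ m`, some mixture of `x` and `m` still beats `f` with utility below the infimum.
    · obtain ⟨α, -, ⟨h0, h1⟩, -, h, -⟩ := hR.archimedean _ _ _ ⟨hxf, hn⟩ ⟨hfm, hmf⟩
      have hle : sInf T ≤ u (mixCons hX α x m) := csInf_le ⟨_, hlb⟩ ⟨_, h.1, rfl⟩
      have hlt : u m < u x := by
        by_contra! hle'
        exact hmf (hR.transitive _ _ _ ((hu.represents _ _).2 hle') hxf)
      rw [hu.affine, ← hx] at hle
      have h1' : (α : ℝ) < 1 := h1
      nlinarith
  have hxf : R (Act.const h𝒜 x) f := by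
    by_contra hn
    by_cases hfM : R f (Act.const h𝒜 M)
    · have : sInf T < u M := by
        rw [← hx]
        by_contra! hle
        exact hn (hR.transitive _ _ _ ((hu.represents _ _).2 hle) hMf)
      obtain ⟨_, ⟨z, hz, rfl⟩, hlt⟩ := (csInf_lt_iff ⟨_, hlb⟩ ⟨_, hMT⟩).1 this
      exact hlt.not_ge ((hu.represents _ _).1 (hR.transitive _ _ _ hz hfM))
    -- If `M ≻ f ≻ x`, some mixture of `M` and `x` is worse than `f`, yet its utility exceeds the
    -- infimum.
    · obtain ⟨-, β, -, ⟨h0, h1⟩, -, h⟩ := hR.archimedean _ _ _ ⟨hMf, hfM⟩ ⟨hfx, hn⟩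
      have hlt : u x < u M := by
        by_contra! hle
        exact hn (hR.transitive _ _ _ ((hu.represents _ _).2 hle) hMf)
      have hlt' : sInf T < u (mixCons hX β M x) := by
        have h0' : 0 < (β : ℝ) := h0
        rw [hu.affine, ← hx]
        nlinarith
      obtain ⟨_, ⟨z, hz, rfl⟩, hlt⟩ := (csInf_lt_iff ⟨_, hlb⟩ ⟨_, hMT⟩).1 hlt'
      exact h.2 (hR.transitive _ _ _ ((hu.represents _ _).2 hlt.le) hz)
  exact ⟨x, hfx, hxf⟩

/-- This is constant-linearity of `I`. The weight `0`, outside C-independence, is included because a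
separation coefficient may vanish. -/
theorem IsIBPreference.indiff_mix (hR : IsIBPreference h𝒜 hX R) (hu : IsUtilityIndex h𝒜 hX R u)
    {f : Act 𝒜 X} {x : X} (hf : Indiff R f (Act.const h𝒜 x)) (α : unitInterval) (hα : α < 1)
    (y : X) :
    Indiff R (Act.mix h𝒜 hX α f (Act.const h𝒜 y)) (Act.const h𝒜 (mixCons hX α x y)) := by
  rcases eq_or_lt_of_le α.2.1 with h0 | h0
  · constructor <;> refine hR.of_util_le hu fun s => ?_ <;>
      simp [Act.mix, Act.const, hu.affine, ← h0]
  · exact ⟨(hR.c_independence _ _ y α h0 hα).1 hf.1, (hR.c_independence _ _ y α h0 hα).1 hf.2⟩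

/-- Applying `I` to both sides would give `ε ≤ 0`. As `u(X)` may be bounded, the inequality is first
shrunk by a small `t` and realized by mixtures of `f` and `g` with constants. -/
theorem IsIBPreference.not_forall_add_le (hR : IsIBPreference h𝒜 hX R)
    (hu : IsUtilityIndex h𝒜 hX R u) {f g : Act 𝒜 X} {x y : X}
    (hf : Indiff R f (Act.const h𝒜 x)) (hg : Indiff R g (Act.const h𝒜 y)) {a b ε : ℝ}
    (ha : 0 ≤ a) (hb : 0 ≤ b) (hε : 0 < ε) :
    ¬ ∀ s, a * (u (f.toFun s) - u x) + ε ≤ b * (u (g.toFun s) - u y) := by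
  intro h
  obtain ⟨x₀, x₁, hlt⟩ := hu.exists_lt
  obtain ⟨d, hd, hd'⟩ : ∃ d, 0 < d ∧ d = (u x₁ - u x₀) / 2 := ⟨_, by linarith, rfl⟩
  obtain ⟨z, hz⟩ : ∃ z, u z = (u x₀ + u x₁) / 2 := hu.exists_eq (x := x₀) (y := x₁)
    (by linarith) (by linarith)
  -- `g` is mixed with the midpoint `z` at weight `t * b`, and `f` with `w` at weight `t * a`. `K`
  -- is the correction to `u w` that makes dominance of the mixtures exactly `t` times `h`; small
  -- `t` keeps `u w` within `d` of the midpoint.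
  obtain ⟨K, hK⟩ : ∃ K, K = a * (u z - u x) + b * (u y - u z) + ε := ⟨_, rfl⟩
  obtain ⟨t, ht, hta, htb, htK⟩ :
      ∃ t : ℝ, 0 < t ∧ t * a ≤ 1 / 2 ∧ t * b ≤ 1 / 2 ∧ t * |K| ≤ d / 2 := by
    have hD : 0 < 1 + 2 * a + 2 * b + 2 * |K| / d := by positivity
    have hKd : 0 ≤ 2 * |K| / d := by positivity
    refine ⟨1 / (1 + 2 * a + 2 * b + 2 * |K| / d), by positivity, ?_, ?_, ?_⟩
    · rw [one_div_mul_eq_div, div_le_iff₀ hD]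
      linarith
    · rw [one_div_mul_eq_div, div_le_iff₀ hD]
      linarith
    · rw [one_div_mul_eq_div, div_le_iff₀ hD]
      have : d / 2 * (2 * |K| / d) = |K| := by field_simp
      nlinarith [mul_nonneg hd.le ha, mul_nonneg hd.le hb]
  have hta0 : 0 ≤ t * a := by positivity
  have htb0 : 0 ≤ t * b := by positivity
  have hpos : 0 < 1 - t * a := by linarith
  have habs : |t * K / (1 - t * a)| ≤ d := by
    rw [abs_div, abs_mul, abs_of_pos ht, abs_of_pos hpos, div_le_iff₀ hpos]
    nlinarith
  obtain ⟨w, hw⟩ : ∃ w, u w = u z + t * K / (1 - t * a) := hu.exists_eq (x := x₀) (y := x₁)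
    (by linarith [(abs_le.1 habs).1]) (by linarith [(abs_le.1 habs).2])
  have hw' : (1 - t * a) * u w = (1 - t * a) * u z + t * K := by
    rw [hw]
    field_simp
  let α : unitInterval := ⟨t * a, hta0, by linarith⟩
  let β : unitInterval := ⟨t * b, htb0, by linarith⟩
  have hf' := hR.indiff_mix hu hf α (Subtype.mk_lt_mk.2 (by linarith)) w
  have hg' := hR.indiff_mix hu hg β (Subtype.mk_lt_mk.2 (by linarith)) z
  have hle : u (mixCons hX α x w) ≤ u (mixCons hX β y z) := by
    refine (hR.iff_of_indiff hu hg' hf').1 (hR.of_util_le hu fun s => ?_)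
    simp only [Act.mix, Act.const, hu.affine, α, β]
    have := mul_le_mul_of_nonneg_left (h s) ht.le
    rw [hw', hK]
    linarith
  simp only [hu.affine, α, β] at hle
  rw [hw', hK] at hle
  nlinarith [mul_pos ht hε]

theorem IsIBPreference.setOf_le_integral_mem_maxminFamily [Nonempty S]
    (hR : IsIBPreference h𝒜 hX R) (hu : IsUtilityIndex h𝒜 hX R u) {f : Act 𝒜 X} {x : X}
    (hf : Indiff R f (Act.const h𝒜 x)) :
    {p : FinAddProb 𝒜 | u x ≤ p.integral (f.util h𝒜 u)} ∈ maxminFamily h𝒜 R u := by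
  have := FinAddProb.compactSpace h𝒜
  have hcomp : IsCompact {p : FinAddProb 𝒜 | u x ≤ p.integral (f.util h𝒜 u)} :=
    (isClosed_le continuous_const (FinAddProb.continuous_integral _)).isCompact
  refine ⟨isConvex_setOf_le_integral _ _, hcomp, fun g => ?_⟩
  obtain ⟨y, hy⟩ := hR.exists_indiff_const hu g
  rcases FinAddProb.exists_le_integral_or h𝒜 (f.util h𝒜 u) (g.util h𝒜 u) (u x) (u y) with
    ⟨p, hpf, hpg⟩ | ⟨a, b, ε, ha, hb, hε, h⟩
  · obtain ⟨m, hm⟩ := (hcomp.image (FinAddProb.continuous_integral (g.util h𝒜 u))).exists_isLeast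
      ⟨_, p, hpf, rfl⟩
    refine ⟨m, hm, fun y' hy' => (hm.2 ⟨p, hpf, rfl⟩).trans (hpg.trans ?_)⟩
    exact (hR.iff_of_indiff hu hy' hy).1 (hR.refl g)
  · exact absurd h (hR.not_forall_add_le hu hf hy ha hb hε)

/-- The bounded range of `φ` is mapped by a positive affine map into a nondegenerate interval of
`u(X)`. -/
theorem IsNonconstAffine.exists_act_util_eq (hu : IsNonconstAffine hX u)
    (h𝒜 : MeasureTheory.IsSetAlgebra 𝒜) (φ : SimpleFun 𝒜 ℝ) :
    ∃ (t c : ℝ) (f : Act 𝒜 X), 0 < t ∧ ∀ s, u (f.toFun s) = t * φ.toFun s + c := by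
  obtain ⟨x, y, hlt⟩ := hu.exists_lt
  obtain ⟨B, hB⟩ := φ.isSimple.1.isBounded.exists_norm_le
  obtain ⟨N, hN, hφ⟩ : ∃ N > 0, ∀ s, |φ.toFun s| ≤ N :=
    ⟨|B| + 1, by positivity, fun s => (hB _ ⟨s, rfl⟩).trans (by linarith [le_abs_self B])⟩
  have hg : ∀ r : ℝ, ∃ z, |r| ≤ N →
      u z = (u y - u x) / (2 * N) * r + (u x + u y) / 2 := by
    intro r
    by_cases hr : |r| ≤ N
    · have hk : |(u y - u x) / (2 * N) * r| ≤ (u y - u x) / 2 := by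
        rw [abs_mul, abs_of_pos (div_pos (sub_pos.2 hlt) (by positivity)), div_mul_eq_mul_div,
          div_le_div_iff₀ (by positivity) two_pos]
        nlinarith
      obtain ⟨z, hz⟩ := hu.exists_eq (x := x) (y := y)
        (r := (u y - u x) / (2 * N) * r + (u x + u y) / 2)
        (by linarith [(abs_le.1 hk).1]) (by linarith [(abs_le.1 hk).2])
      exact ⟨z, fun _ => hz⟩
    -- A dummy value for arguments that `φ` never takes, so that the choice is a total function.
    · exact ⟨x, fun h => absurd h hr⟩
  choose g hg using hg
  exact ⟨_, _, ⟨_, φ.isSimple.comp h𝒜 g⟩, div_pos (sub_pos.2 hlt) (by positivity),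
    fun s => hg _ (hφ s)⟩

theorem IsIBPreference.mem_of_mem_maxminFamily [Nonempty S] (hR : IsIBPreference h𝒜 hX R)
    (hu : IsUtilityIndex h𝒜 hX R u) {q : FinAddProb 𝒜} (hq : {q} ∈ minmaxFamily h𝒜 R u)
    {P : Set (FinAddProb 𝒜)} (hP : P ∈ maxminFamily h𝒜 R u) : q ∈ P := by
  rw [singleton_mem_minmaxFamily_iff] at hq
  obtain ⟨hconv, hcomp, hP⟩ := hP
  by_contra hqP
  obtain ⟨φ, hφ⟩ := FinAddProb.exists_integral_lt h𝒜 hconv hcomp hqP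
  obtain ⟨t, c, f, ht, hf⟩ := hu.exists_act_util_eq h𝒜 φ
  obtain ⟨x, hx⟩ := hR.exists_indiff_const hu f
  obtain ⟨m, ⟨⟨p, hp, hpm⟩, -⟩, hm⟩ := hP f
  have key : ∀ p : FinAddProb 𝒜, p.integral (f.util h𝒜 u) = t * p.integral φ + c := fun p => by
    simpa using p.integral_add_mul h𝒜 φ φ (f.util h𝒜 u) t 0 c fun s => by
      simpa [Act.util] using hf s
  have h₁ := hq f x hx
  have h₂ := hm x hx
  simp only [key] at hpm h₁
  have := mul_lt_mul_of_pos_left (hφ p hp) ht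
  linarith

/-- The barycenter is indifferent to `f` for the benchmark and has `u`-value `∫ u(f) dq`, so `v`
need not be compared with `u`. -/
theorem IsIBPreference.exists_singleton_of_isAmbiguityAverse (hR : IsIBPreference h𝒜 hX R)
    (hu : IsUtilityIndex h𝒜 hX R u) (h : IsAmbiguityAverse h𝒜 hX R) :
    ∃ q : FinAddProb 𝒜, {q} ∈ minmaxFamily h𝒜 R u := by
  obtain ⟨R₀, ⟨v, q, hv, hR₀⟩, h⟩ := h
  refine ⟨q, singleton_mem_minmaxFamily_iff q |>.2 fun f x hx => ?_⟩
  obtain ⟨y, hvy, huy⟩ := hv.exists_barycenter (h𝒜 := h𝒜) hu.toIsNonconstAffine q f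
  rw [← huy, ← hu.represents]
  refine hR.transitive _ _ _ (h f y ((hR₀ _ _).2 ?_)) hx.1
  rw [q.integral_const h𝒜 ((Act.const h𝒜 y).util h𝒜 v) (v y) fun _ => rfl, hvy]

theorem IsIBPreference.isAmbiguityAverse_of_singleton [Nonempty S]
    (hR : IsIBPreference h𝒜 hX R) (hu : IsUtilityIndex h𝒜 hX R u) {q : FinAddProb 𝒜}
    (hq : {q} ∈ minmaxFamily h𝒜 R u) : IsAmbiguityAverse h𝒜 hX R := by
  rw [singleton_mem_minmaxFamily_iff] at hq
  refine ⟨_, ⟨u, q, hu.toIsNonconstAffine, fun _ _ => Iff.rfl⟩, fun f y hy => ?_⟩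
  obtain ⟨x, hx⟩ := hR.exists_indiff_const hu f
  rw [q.integral_const h𝒜 ((Act.const h𝒜 y).util h𝒜 u) (u y) fun _ => rfl] at hy
  exact hR.transitive _ _ _ ((hu.represents _ _).2 ((hq f x hx).trans hy)) hx.2

end Preference

end IBPref

theorem mainTheorem9 {S : Type*} [Nonempty S] {𝒜 : Set (Set S)}
    (h𝒜 : MeasureTheory.IsSetAlgebra 𝒜) {E : Type*} [AddCommGroup E] [Module ℝ E] {X : Set E}
    (hX : Convex ℝ X) (R : IBPref.Act 𝒜 X → IBPref.Act 𝒜 X → Prop)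
    (hR : IBPref.IsIBPreference h𝒜 hX R)
    (u : X → ℝ) (hu : IBPref.IsUtilityIndex h𝒜 hX R u) :
    List.TFAE
      [IBPref.IsAmbiguityAverse h𝒜 hX R,
        (⋂ P ∈ IBPref.maxminFamily h𝒜 R u, P).Nonempty,
        ∃ p₀ : IBPref.FinAddProb 𝒜, {p₀} ∈ IBPref.minmaxFamily h𝒜 R u] := by
  tfae_have 1 → 3 := hR.exists_singleton_of_isAmbiguityAverse hu
  tfae_have 3 → 1 := fun ⟨_, hq⟩ => hR.isAmbiguityAverse_of_singleton hu hq
  tfae_have 3 → 2 := fun ⟨q, hq⟩ =>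
    ⟨q, Set.mem_iInter₂.2 fun _ hP => hR.mem_of_mem_maxminFamily hu hq hP⟩
  tfae_have 2 → 3 := fun ⟨q, hq⟩ =>
    ⟨q, (IBPref.singleton_mem_minmaxFamily_iff q).2 fun _ _ hf =>
      Set.mem_iInter₂.1 hq _ (hR.setOf_le_integral_mem_maxminFamily hu hf)⟩
  tfae_finish
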